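/- Let $N$ be a nonnegative integer and let $\mathcal{P}(x)=\sum_{n=0}^{N}a_nx^n$ be a real polynomial with $\mathcal{P}(x)>0$ for every $x\in[0,1]$. Let $PW^2$ be the space of entire functions $g:\mathbb{C}\to\mathbb{C}$ of exponential type at most $\pi$ (that is, for every $\varepsilon>0$ there is $C_\varepsilon>0$ with $|g(z)|\le C_\varepsilon e^{(\pi+\varepsilon)|z|}$ for all $z\in\mathbb{C}$) whose restriction to $\mathbb{R}$ belongs to $L^2(\mathbb{R})$. Then for every $g\in PW^2$ with $g(0)=1$ the functions $|g^{(n)}|^2$, $0\le n\le N$, are integrable on $\mathbb{R}$ and $$\left(\int_{0}^{1}\frac{dt}{\mathcal{P}(t^2)}\right)^{-1}\leq \int_{-\infty}^{\infty}\sum_{n=0}^{N}\frac{a_n}{\pi^{2n}}\,\bigl|g^{(n)}(x)\bigr|^2\,dx .$$ Moreover, for such $g$, equality holds if and only if $$g(z)=\left(\int_{0}^{1}\frac{dt}{\mathcal{P}(t^2)}\right)^{-1}\int_{0}^{1}\frac{\cos(\pi zt)}{\mathcal{P}(t^2)}\,dt\qquad\text{for all } z\in\mathbb{C},$$ and the function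 on the right-hand side does belong to $PW^2$ and takes the value $1$ at $0$, so that equality is attained. -/

import Mathlib

open MeasureTheory

/-- `g` has exponential type at most `τ`: for every `ε > 0` there is `C > 0` with
`|g z| ≤ C * exp ((τ + ε) * |z|)` on the whole complex plane. -/
def HasExpTypeAtMost (g : ℂ → ℂ) (τ : ℝ) : Prop :=
  ∀ ε : ℝ, 0 < ε → ∃ C : ℝ, 0 < C ∧ ∀ z : ℂ, ‖g z‖ ≤ C * Real.exp ((τ + ε) * ‖z‖)

/-- The Paley-Wiener space: entire functions of exponential type at most `π` whose restriction
to the real line is square integrable. -/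
def PW2 : Set (ℂ → ℂ) :=
  {g | Differentiable ℂ g ∧ HasExpTypeAtMost g Real.pi ∧
    MemLp (fun x : ℝ => g (x : ℂ)) 2 volume}

/-- The real polynomial function `a 0 + a 1 * x + ... + a N * x ^ N`. -/
def polyFun (N : ℕ) (a : ℕ → ℝ) (x : ℝ) : ℝ :=
  ∑ n ∈ Finset.range (N + 1), a n * x ^ n

/-- The integral of `1 / P (t ^ 2)` over `[0, 1]`. -/
noncomputable def recipIntegral (N : ℕ) (a : ℕ → ℝ) : ℝ :=
  ∫ t in (0 : ℝ)..1, 1 / polyFun N a (t ^ 2)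

/-- The integrand `∑ n ≤ N, (a n / π ^ (2 n)) |g^(n) (x)| ^ 2`; `g^(n)` is the `n`-th complex
derivative of `g`, evaluated at the real point `x`. -/
noncomputable def energyDensity (N : ℕ) (a : ℕ → ℝ) (g : ℂ → ℂ) (x : ℝ) : ℝ :=
  ∑ n ∈ Finset.range (N + 1),
    a n / Real.pi ^ (2 * n) * ‖iteratedDeriv n g (x : ℂ)‖ ^ 2

/-- The function
`z ↦ (∫ t in 0..1, 1 / P (t ^ 2))⁻¹ * ∫ t in 0..1, cos (π z t) / P (t ^ 2)`. -/
noncomputable def extremalFun (N : ℕ) (a : ℕ → ℝ) (z : ℂ) : ℂ :=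
  ((recipIntegral N a : ℝ) : ℂ)⁻¹ *
    ∫ t in (0 : ℝ)..1,
      Complex.cos ((Real.pi : ℂ) * z * (t : ℂ)) / ((polyFun N a (t ^ 2) : ℝ) : ℂ)

/-! By Paley–Wiener (`exists_isBandFun_of_mem_PW2`), every `g` in `PW2` is `fourierLaplace φ` with
`φ` in `L²` supported in `[-1/2, 1/2]`. Plancherel turns the energy into `∫ |φ(s)|² P(4s²) ds`, and
`g 0 = 1` becomes `∫ φ = 1`. Put `I = recipIntegral N a` and `ψ = 1 / (I P(4s²))` on the band. As `ψ
P` is the constant `1/I` there, completing the square (`integral_norm_sq_mul_polyFun`) gives energy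
`1/I + ∫ |φ - ψ|² P`. The inequality follows, with equality exactly when `φ = ψ` almost everywhere;
`ψ` is the density of `extremalFun`.

For Paley–Wiener, let `Φ` be the `L²` Fourier transform of `g`. Convolving `g` with a Gaussian keeps
the exponential type and multiplies `Φ` by a Gaussian, so the Fourier–Laplace integral converges on
all of `ℂ` before anything is known about the support of `Φ`. Plancherel on the line of height `y`
produces the weight `exp(-4πys)`, while Phragmén–Lindelöf limits growth in `y` to `exp(2π|y|)`
(`HasExpTypeAtMost.integral_horizontal_le`). Letting `y → ±∞` forces `Φ = 0` outside the band. -/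

open Filter Topology FourierTransform Set

/-! ### Holomorphic parameter integrals and Phragmén–Lindelöf bounds. -/

/-- Holomorphy of an integral of entire functions that is locally dominated in the parameter. -/
theorem differentiable_integral_of_dominated {α : Type*} [MeasurableSpace α] {μ : Measure α}
    {F : ℂ → α → ℂ} (hmeas : ∀ z, AEStronglyMeasurable (F z) μ)
    (hdiff : ∀ a, Differentiable ℂ (fun z => F z a))
    (hbound : ∀ R : ℝ, ∃ b : α → ℝ, Integrable b μ ∧ ∀ z, ‖z‖ ≤ R → ∀ a, ‖F z a‖ ≤ b a) :
    Differentiable ℂ (fun z => ∫ a, F z a ∂μ) := by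
  intro z₀
  -- The parameter moves in a unit ball and Cauchy's estimate uses a unit circle around it, hence
  -- radius `‖z₀‖ + 2`.
  obtain ⟨b, hb, hFb⟩ := hbound (‖z₀‖ + 2)
  have hint : Integrable (F z₀) μ :=
    hb.mono' (hmeas z₀) (Eventually.of_forall fun a => hFb z₀ (by linarith) a)
  have hF'meas : AEStronglyMeasurable (fun a => deriv (fun z => F z a) z₀) μ := by
    have hu : Tendsto (fun n : ℕ => (((n : ℝ) + 1)⁻¹ : ℝ)) atTop (𝓝 0) := by
      simpa using tendsto_one_div_add_atTop_nhds_zero_nat (𝕜 := ℝ)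
    -- The derivative is measurable as a pointwise limit of difference quotients with steps
    -- `1/(n+1)`.
    refine aestronglyMeasurable_of_tendsto_ae atTop
      (f := fun (n : ℕ) a => ((((n : ℝ) + 1)⁻¹ : ℝ) : ℂ)⁻¹ *
        (F (z₀ + ((((n : ℝ) + 1)⁻¹ : ℝ) : ℂ)) a - F z₀ a)) (fun n => ?_) ?_
    · exact ((hmeas _).sub (hmeas _)).const_mul _
    · refine Eventually.of_forall fun a => ?_
      have h := (hdiff a z₀).hasDerivAt.tendsto_slope_zero
      refine h.comp (tendsto_nhdsWithin_iff.2 ⟨?_, Eventually.of_forall fun n => ?_⟩)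
      · exact (Complex.continuous_ofReal.tendsto' 0 0 Complex.ofReal_zero).comp hu
      · have : ((n : ℝ) + 1)⁻¹ ≠ 0 := by positivity
        exact Complex.ofReal_ne_zero.2 this
  refine (hasDerivAt_integral_of_dominated_loc_of_deriv_le (𝕜 := ℂ) (s := Metric.ball z₀ 1)
    (F' := fun z a => deriv (fun w => F w a) z) (bound := b)
    (Metric.ball_mem_nhds _ one_pos) (Eventually.of_forall hmeas) hint hF'meas
    (Eventually.of_forall fun a z hz => ?_) hb
    (Eventually.of_forall fun a z _ => (hdiff a z).hasDerivAt)).2.differentiableAt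
  have := Complex.norm_deriv_le_of_forall_mem_sphere_norm_le (f := fun w => F w a) (c := z)
    (R := 1) (C := b a) one_pos (hdiff a).diffContOnCl (fun w hw => hFb w ?_ a)
  · simpa using this
  · have h1 : ‖w - z‖ = 1 := by simpa [dist_eq_norm] using hw
    have h2 : ‖z - z₀‖ < 1 := by simpa [dist_eq_norm] using hz
    calc ‖w‖ = ‖(w - z) + (z - z₀) + z₀‖ := by ring_nf
      _ ≤ ‖w - z‖ + ‖z - z₀‖ + ‖z₀‖ := norm_add₃_le
      _ ≤ _ := by linarith

/-- The rotation `w ↦ I w` carries the right half-plane to the upper one. The factor `exp(-(τ+ε)w)`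
has modulus one on the imaginary axis and makes the product bounded on the positive real axis, so
Phragmén–Lindelöf applies; then `ε → 0`. -/
theorem HasExpTypeAtMost.norm_le_of_im_nonneg {k : ℂ → ℂ} {τ M : ℝ} (hk : Differentiable ℂ k)
    (htype : HasExpTypeAtMost k τ) (hM : ∀ x : ℝ, ‖k x‖ ≤ M) {z : ℂ} (hz : 0 ≤ z.im) :
    ‖k z‖ ≤ M * Real.exp (τ * z.im) := by
  have key : ∀ ε : ℝ, 0 < ε → ‖k z‖ ≤ M * Real.exp ((τ + ε) * z.im) := by
    intro ε hε
    obtain ⟨C, hC, hkC⟩ := htype ε hε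
    set f : ℂ → ℂ := fun w => k (Complex.I * w) * Complex.exp (-((τ + ε : ℝ) : ℂ) * w) with hf
    have hfnorm : ∀ w, ‖f w‖ = ‖k (Complex.I * w)‖ * Real.exp (-(τ + ε) * w.re) := by
      intro w
      simp only [hf, norm_mul, Complex.norm_exp]
      congr 2
      rw [← Complex.ofReal_neg, Complex.re_ofReal_mul]
    have hfd : Differentiable ℂ f := by
      have : Differentiable ℂ (fun w => k (Complex.I * w)) := hk.comp (by fun_prop)
      exact this.mul (by fun_prop)
    have hw := PhragmenLindelof.right_half_plane_of_bounded_on_real (f := f) (C := M)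
      (z := -Complex.I * z) hfd.diffContOnCl ⟨1, by norm_num, 2 * |τ + ε|, ?_⟩ ?_ ?_ (by simpa using hz)
    · rw [hfnorm] at hw
      have e1 : Complex.I * (-Complex.I * z) = z := by
        rw [← mul_assoc]; simp
      rw [e1] at hw
      have e2 : (-Complex.I * z).re = z.im := by simp
      rw [e2] at hw
      calc ‖k z‖ = ‖k z‖ * Real.exp (-(τ + ε) * z.im) * Real.exp ((τ + ε) * z.im) := by
            rw [mul_assoc, ← Real.exp_add, neg_mul, neg_add_cancel]; simp
        _ ≤ _ := by gcongr
    · refine Asymptotics.IsBigO.of_bound C (Eventually.of_forall fun w => ?_)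
      rw [hfnorm, Real.norm_of_nonneg (Real.exp_nonneg _), Real.rpow_one]
      calc ‖k (Complex.I * w)‖ * Real.exp (-(τ + ε) * w.re)
          ≤ C * Real.exp ((τ + ε) * ‖w‖) * Real.exp (|τ + ε| * ‖w‖) := by
            refine mul_le_mul (by simpa using hkC (Complex.I * w)) (Real.exp_le_exp.2 ?_)
              (by positivity) (by positivity)
            calc -(τ + ε) * w.re ≤ |-(τ + ε) * w.re| := le_abs_self _
              _ = |τ + ε| * |w.re| := by rw [abs_mul, abs_neg]
              _ ≤ _ := by gcongr; exact Complex.abs_re_le_norm w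
        _ ≤ C * Real.exp (|τ + ε| * ‖w‖) * Real.exp (|τ + ε| * ‖w‖) := by
            gcongr
            exact le_abs_self _
        _ = _ := by rw [mul_assoc, ← Real.exp_add]; ring_nf
    · refine isBoundedUnder_of_eventually_le (a := C) ?_
      filter_upwards [eventually_ge_atTop 0] with x hx
      rw [hfnorm]
      calc ‖k (Complex.I * x)‖ * Real.exp (-(τ + ε) * (x : ℂ).re)
          ≤ C * Real.exp ((τ + ε) * x) * Real.exp (-(τ + ε) * x) := by
            refine mul_le_mul (by simpa [abs_of_nonneg hx] using hkC (Complex.I * x)) (by simp)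
              (by positivity) (by positivity)
        _ = C := by rw [mul_assoc, ← Real.exp_add, neg_mul, add_neg_cancel]; simp
    · intro x
      rw [hfnorm]
      have : Complex.I * (x * Complex.I) = ((-x : ℝ) : ℂ) := by
        rw [mul_comm (x : ℂ), ← mul_assoc]; simp
      rw [this]
      simpa using hM (-x)
  have hlim : Tendsto (fun ε : ℝ => M * Real.exp ((τ + ε) * z.im)) (𝓝[>] 0)
      (𝓝 (M * Real.exp (τ * z.im))) :=
    (Continuous.tendsto' (by fun_prop) _ _ (by simp)).mono_left nhdsWithin_le_nhds
  exact ge_of_tendsto hlim (by filter_upwards [self_mem_nhdsWithin] with ε hε using key ε hε)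

/-- An entire function of exponential type `τ` bounded by `M` on the real line is bounded by
`M * exp (τ * |Im z|)`. -/
theorem HasExpTypeAtMost.norm_le {k : ℂ → ℂ} {τ M : ℝ} (hk : Differentiable ℂ k)
    (htype : HasExpTypeAtMost k τ) (hM : ∀ x : ℝ, ‖k x‖ ≤ M) (z : ℂ) :
    ‖k z‖ ≤ M * Real.exp (τ * |z.im|) := by
  rcases le_total 0 z.im with h | h
  · rw [abs_of_nonneg h]
    exact htype.norm_le_of_im_nonneg hk hM h
  · rw [abs_of_nonpos h]
    have := HasExpTypeAtMost.norm_le_of_im_nonneg (k := fun w => k (-w)) (τ := τ) (M := M)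
      (hk.comp differentiable_neg) (fun ε hε => ?_) (fun x => ?_) (z := -z) (by simpa using h)
    · simpa using this
    · obtain ⟨C, hC, hkC⟩ := htype ε hε
      exact ⟨C, hC, fun w => by simpa using hkC (-w)⟩
    · simpa using hM (-x)

/-! ### Plancherel on `L¹ ∩ L²`. -/

/-- On `L¹ ∩ L²` the inverse Fourier transform of `L²` is given by the integral. -/
theorem fourierInv_toLp_ae_eq {f : ℝ → ℂ} (h1 : Integrable f) (h2 : MemLp f 2) :
    ((𝓕⁻ (h2.toLp f) : Lp (α := ℝ) ℂ 2 volume) : ℝ → ℂ) =ᵐ[volume] 𝓕⁻ f := by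
  have hL : Continuous fun p : ℝ × ℝ => (-innerₗ ℝ : ℝ →ₗ[ℝ] ℝ →ₗ[ℝ] ℝ) p.1 p.2 := by
    exact Continuous.neg (continuous_inner (𝕜 := ℝ) (E := ℝ))
  have hcont : Continuous (𝓕⁻ f) :=
    VectorFourier.fourierIntegral_continuous Real.continuous_fourierChar hL h1
  -- Both functions are tested against smooth compactly supported `φ`: the `L²` transform is moved
  -- onto `φ` through tempered distributions, the integral transform by Fubini.
  refine ae_eq_of_integral_contDiff_smul_eq
    ((Lp.memLp _).locallyIntegrable (by norm_num)) hcont.locallyIntegrable fun φ hφ hsupp => ?_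
  have hs1 : HasCompactSupport (Complex.ofRealCLM ∘ φ) := hsupp.comp_left rfl
  have hs2 : ContDiff ℝ ((⊤ : ℕ∞) : WithTop ℕ∞) (Complex.ofRealCLM ∘ φ) := by fun_prop
  set χ : SchwartzMap ℝ ℂ := hs1.toSchwartzMap hs2 with hχ
  have hχφ : ∀ x, χ x = (φ x : ℂ) := fun x => rfl
  have h3 := congrArg (fun T : TemperedDistribution ℝ ℂ => T χ)
    (Lp.fourierInv_toTemperedDistribution_eq (h2.toLp f))
  simp only [TemperedDistribution.fourierInv_apply, Lp.toTemperedDistribution_apply] at h3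
  have h4 := VectorFourier.integral_fourierIntegral_smul_eq_flip (μ := volume) (ν := volume)
    (f := χ) (g := f) Real.continuous_fourierChar hL χ.integrable h1
  have hflip : (-innerₗ ℝ : ℝ →ₗ[ℝ] ℝ →ₗ[ℝ] ℝ).flip = -innerₗ ℝ := by
    ext; simp
  rw [hflip] at h4
  have h5 : ∫ x, (𝓕⁻ χ) x • (h2.toLp f) x = ∫ x, χ x • 𝓕⁻ f x := by
    refine Eq.trans (integral_congr_ae ?_) h4
    filter_upwards [h2.coeFn_toLp] with x hx
    rw [hx, SchwartzMap.fourierInv_coe]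
    rfl
  rw [h5] at h3
  simp only [hχφ, Complex.coe_smul] at h3
  exact h3.symm

/-- **Plancherel's theorem** on `L¹ ∩ L²`. -/
theorem memLp_fourierInv {f : ℝ → ℂ} (h1 : Integrable f) (h2 : MemLp f 2) :
    MemLp (𝓕⁻ f) 2 :=
  (memLp_congr_ae (fourierInv_toLp_ae_eq h1 h2)).1 (Lp.memLp _)

theorem integral_norm_sq_eq_norm_toLp_sq {f : ℝ → ℂ} (h2 : MemLp f 2) :
    ∫ x, ‖f x‖ ^ 2 = ‖h2.toLp f‖ ^ 2 := by
  have := L2.inner_def (𝕜 := ℂ) (h2.toLp f) (h2.toLp f)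
  rw [inner_self_eq_norm_sq_to_K] at this
  have h3 : (∫ a, inner ℂ (h2.toLp f a) (h2.toLp f a)) = ((∫ x, ‖f x‖ ^ 2 : ℝ) : ℂ) := by
    rw [← integral_complex_ofReal]
    refine integral_congr_ae ?_
    filter_upwards [h2.coeFn_toLp] with x hx
    rw [hx, inner_self_eq_norm_sq_to_K]
    norm_cast
  rw [h3] at this
  refine Complex.ofReal_injective (this.symm.trans ?_)
  push_cast
  rfl

theorem integral_norm_fourierInv_sq {f : ℝ → ℂ} (h1 : Integrable f) (h2 : MemLp f 2) :
    ∫ x, ‖𝓕⁻ f x‖ ^ 2 = ∫ s, ‖f s‖ ^ 2 := by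
  rw [integral_norm_sq_eq_norm_toLp_sq h2, integral_norm_sq_eq_norm_toLp_sq (memLp_fourierInv h1 h2)]
  have : (memLp_fourierInv h1 h2).toLp (𝓕⁻ f) = 𝓕⁻ (h2.toLp f) := by
    refine Lp.ext ?_
    exact (MemLp.coeFn_toLp _).trans (fourierInv_toLp_ae_eq h1 h2).symm
  rw [this, ← Lp.norm_fourier_eq, FourierTransform.fourier_fourierInv_eq]

/-! ### Fourier–Laplace transforms of band-limited densities. -/

/-- The Fourier–Laplace transform `z ↦ ∫ φ(s) exp (2 π i z s) ds`. -/
noncomputable def fourierLaplace (φ : ℝ → ℂ) (z : ℂ) : ℂ :=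
  ∫ s : ℝ, φ s * Complex.exp (2 * Real.pi * Complex.I * z * s)

theorem fourierLaplace_ofReal (φ : ℝ → ℂ) (x : ℝ) : fourierLaplace φ x = 𝓕⁻ φ x := by
  rw [Real.fourierInv_eq', fourierLaplace]
  congr 1 with s
  rw [smul_eq_mul, mul_comm]
  congr 2
  simp
  ring

theorem fourierLaplace_congr_ae {φ ψ : ℝ → ℂ} (h : φ =ᵐ[volume] ψ) :
    fourierLaplace φ = fourierLaplace ψ := by
  ext z
  refine integral_congr_ae ?_
  filter_upwards [h] with s hs
  rw [hs]

/-- Square integrable functions supported in `[-1/2, 1/2]`. -/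
structure IsBandFun (φ : ℝ → ℂ) : Prop where
  memLp : MemLp φ 2
  eq_zero : ∀ s, s ∉ Icc (-(1 / 2) : ℝ) (1 / 2) → φ s = 0

namespace IsBandFun

variable {φ : ℝ → ℂ}

theorem integrable (h : IsBandFun φ) : Integrable φ := by
  rw [← integrableOn_iff_integrable_of_support_subset (s := Icc (-(1 / 2) : ℝ) (1 / 2))]
  · have : MemLp φ 2 (volume.restrict (Icc (-(1 / 2) : ℝ) (1 / 2))) := h.memLp.restrict _
    exact this.integrable (by norm_num)
  · intro s hs
    by_contra hs'
    exact hs (h.eq_zero s hs')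

theorem mul_of_continuous (h : IsBandFun φ) {u : ℝ → ℂ} (hu : Continuous u) :
    IsBandFun (fun s => φ s * u s) := by
  refine ⟨?_, fun s hs => by simp [h.eq_zero s hs]⟩
  obtain ⟨C, hC⟩ := (isCompact_Icc (a := (-(1 / 2) : ℝ)) (b := 1 / 2)).exists_bound_of_continuousOn
    hu.continuousOn
  refine h.memLp.of_le_mul (c := C) (h.memLp.1.mul hu.aestronglyMeasurable)
    (Eventually.of_forall fun s => ?_)
  by_cases hs : s ∈ Icc (-(1 / 2) : ℝ) (1 / 2)
  · rw [norm_mul, mul_comm]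
    gcongr
    exact hC s hs
  · simp [h.eq_zero s hs]

theorem sub {ψ : ℝ → ℂ} (h : IsBandFun φ) (h' : IsBandFun ψ) :
    IsBandFun (fun s => φ s - ψ s) :=
  ⟨h.memLp.sub h'.memLp, fun s hs => by simp [h.eq_zero s hs, h'.eq_zero s hs]⟩

theorem norm_mul_exp_le (h : IsBandFun φ) (z : ℂ) (s : ℝ) :
    ‖φ s * Complex.exp (2 * Real.pi * Complex.I * z * s)‖ ≤
      ‖φ s‖ * Real.exp (Real.pi * ‖z‖) := by
  by_cases hs : s ∈ Icc (-(1 / 2) : ℝ) (1 / 2)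
  · rw [norm_mul, Complex.norm_exp]
    gcongr
    have h1 : |s| ≤ 1 / 2 := abs_le.2 ⟨hs.1, hs.2⟩
    calc (2 * Real.pi * Complex.I * z * s).re ≤ ‖2 * Real.pi * Complex.I * z * s‖ :=
          Complex.re_le_norm _
      _ = 2 * Real.pi * ‖z‖ * |s| := by simp [abs_of_pos Real.pi_pos]
      _ ≤ 2 * Real.pi * ‖z‖ * (1 / 2) := by gcongr
      _ = _ := by ring
  · simp [h.eq_zero s hs]

theorem aestronglyMeasurable_mul_exp (h : IsBandFun φ) (z : ℂ) :
    AEStronglyMeasurable (fun s : ℝ => φ s * Complex.exp (2 * Real.pi * Complex.I * z * s))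
      volume :=
  h.memLp.1.mul (by fun_prop : Continuous fun s : ℝ =>
    Complex.exp (2 * Real.pi * Complex.I * z * s)).aestronglyMeasurable

theorem integrable_mul_exp (h : IsBandFun φ) (z : ℂ) :
    Integrable (fun s : ℝ => φ s * Complex.exp (2 * Real.pi * Complex.I * z * s)) :=
  (h.integrable.norm.mul_const _).mono' (h.aestronglyMeasurable_mul_exp z)
    (Eventually.of_forall (h.norm_mul_exp_le z))

theorem norm_fourierLaplace_le (h : IsBandFun φ) (z : ℂ) :
    ‖fourierLaplace φ z‖ ≤ (∫ s, ‖φ s‖) * Real.exp (Real.pi * ‖z‖) := by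
  rw [← integral_mul_const]
  exact norm_integral_le_of_norm_le (h.integrable.norm.mul_const _)
    (Eventually.of_forall (h.norm_mul_exp_le z))

theorem hasDerivAt_fourierLaplace (h : IsBandFun φ) (z : ℂ) :
    HasDerivAt (fourierLaplace φ)
      (fourierLaplace (fun s => φ s * (2 * Real.pi * Complex.I * s)) z) z := by
  have h' : IsBandFun (fun s => φ s * (2 * Real.pi * Complex.I * s)) :=
    h.mul_of_continuous (by fun_prop)
  refine (hasDerivAt_integral_of_dominated_loc_of_deriv_le (𝕜 := ℂ) (s := Metric.ball z 1)
    (F := fun z (s : ℝ) => φ s * Complex.exp (2 * Real.pi * Complex.I * z * s))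
    (F' := fun z (s : ℝ) => φ s * (2 * Real.pi * Complex.I * s) *
      Complex.exp (2 * Real.pi * Complex.I * z * s))
    (bound := fun s => ‖φ s * (2 * Real.pi * Complex.I * s)‖ * Real.exp (Real.pi * (‖z‖ + 1)))
    (Metric.ball_mem_nhds _ one_pos) (Eventually.of_forall h.aestronglyMeasurable_mul_exp)
    (h.integrable_mul_exp z) (h'.aestronglyMeasurable_mul_exp z)
    (Eventually.of_forall fun s w hw => (h'.norm_mul_exp_le w s).trans ?_)
    (h'.integrable.norm.mul_const _)
    (Eventually.of_forall fun s w _ => ?_)).2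
  · have : ‖w‖ ≤ ‖z‖ + 1 := by
      have h2 : ‖w - z‖ < 1 := by simpa [dist_eq_norm] using hw
      calc ‖w‖ = ‖z + (w - z)‖ := by ring_nf
        _ ≤ ‖z‖ + ‖w - z‖ := norm_add_le _ _
        _ ≤ _ := by linarith
    gcongr
  · have h1 : HasDerivAt (fun w : ℂ => 2 * Real.pi * Complex.I * w * s)
        (2 * Real.pi * Complex.I * s) w := by
      simpa using ((hasDerivAt_id w).const_mul (2 * Real.pi * Complex.I)).mul_const (s : ℂ)
    convert! h1.cexp.const_mul (φ s) using 1
    ring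

theorem iteratedDeriv_fourierLaplace (h : IsBandFun φ) (n : ℕ) :
    iteratedDeriv n (fourierLaplace φ) =
      fourierLaplace (fun s => φ s * (2 * Real.pi * Complex.I * s) ^ n) := by
  induction n with
  | zero => simp
  | succ n ih =>
    rw [iteratedDeriv_succ, ih]
    ext z
    have h' : IsBandFun (fun s : ℝ => φ s * (2 * Real.pi * Complex.I * s) ^ n) :=
      h.mul_of_continuous (by fun_prop)
    rw [(h'.hasDerivAt_fourierLaplace z).deriv]
    simp only [pow_succ, mul_assoc]

theorem memLp_fourierLaplace (h : IsBandFun φ) :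
    MemLp (fun x : ℝ => fourierLaplace φ x) 2 := by
  simp only [fourierLaplace_ofReal]
  exact memLp_fourierInv h.integrable h.memLp

theorem integral_norm_fourierLaplace_sq (h : IsBandFun φ) :
    ∫ x : ℝ, ‖fourierLaplace φ x‖ ^ 2 = ∫ s, ‖φ s‖ ^ 2 := by
  simp only [fourierLaplace_ofReal]
  exact integral_norm_fourierInv_sq h.integrable h.memLp

theorem fourierLaplace_mem_PW2 (h : IsBandFun φ) : fourierLaplace φ ∈ PW2 := by
  refine ⟨fun z => (h.hasDerivAt_fourierLaplace z).differentiableAt, fun ε hε => ?_,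
    h.memLp_fourierLaplace⟩
  have h0 : 0 ≤ ∫ s, ‖φ s‖ := integral_nonneg fun s => norm_nonneg _
  refine ⟨(∫ s, ‖φ s‖) + 1, by positivity, fun z => (h.norm_fourierLaplace_le z).trans ?_⟩
  gcongr <;> linarith

theorem integrable_norm_sq_mul (h : IsBandFun φ) {u : ℝ → ℝ} (hu : Continuous u) :
    Integrable (fun s => ‖φ s‖ ^ 2 * u s) := by
  have h1 : IsBandFun (fun s => φ s * (u s : ℂ)) := h.mul_of_continuous (by fun_prop)
  have h2 := h.memLp.norm.integrable_mul h1.memLp.norm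
  refine (h2.mono ((h.memLp.1.norm.pow 2).mul hu.aestronglyMeasurable)
    (Eventually.of_forall fun s => ?_))
  simp [pow_two, mul_assoc]

theorem integrable_norm_iteratedDeriv_sq (h : IsBandFun φ) (n : ℕ) :
    Integrable (fun x : ℝ => ‖iteratedDeriv n (fourierLaplace φ) (x : ℂ)‖ ^ 2) := by
  have h' : IsBandFun (fun s : ℝ => φ s * (2 * Real.pi * Complex.I * s) ^ n) :=
    h.mul_of_continuous (by fun_prop)
  rw [h.iteratedDeriv_fourierLaplace n]
  exact h'.memLp_fourierLaplace.integrable_norm_pow (by norm_num)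

theorem integral_norm_iteratedDeriv_sq (h : IsBandFun φ) (n : ℕ) :
    ∫ x : ℝ, ‖iteratedDeriv n (fourierLaplace φ) (x : ℂ)‖ ^ 2 =
      ∫ s, ‖φ s‖ ^ 2 * (2 * Real.pi * s) ^ (2 * n) := by
  have h' : IsBandFun (fun s : ℝ => φ s * (2 * Real.pi * Complex.I * s) ^ n) :=
    h.mul_of_continuous (by fun_prop)
  rw [h.iteratedDeriv_fourierLaplace n, h'.integral_norm_fourierLaplace_sq]
  congr 1 with s
  have : ‖(2 * Real.pi * Complex.I * s : ℂ)‖ = |2 * Real.pi * s| := by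
    simp [abs_mul]
  rw [norm_mul, norm_pow, this, mul_pow, ← pow_mul, mul_comm n 2, Even.pow_abs ⟨n, by ring⟩]

/-- Each derivative multiplies the density by `2πis`; after Plancherel the weight `π^(-2n)` leaves
`(2s)^(2n)`. The variable `2s` runs over `[-1, 1]`, so `P` is evaluated in `[0, 1]` on the band. -/
theorem integral_energyDensity (h : IsBandFun φ) (N : ℕ) (a : ℕ → ℝ) :
    ∫ x : ℝ, energyDensity N a (fourierLaplace φ) x =
      ∫ s, ‖φ s‖ ^ 2 * polyFun N a ((2 * s) ^ 2) := by
  simp only [energyDensity, polyFun, Finset.mul_sum]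
  rw [integral_finsetSum _ fun n _ => (h.integrable_norm_iteratedDeriv_sq n).const_mul _,
    integral_finsetSum _ fun n _ => h.integrable_norm_sq_mul (by fun_prop)]
  refine Finset.sum_congr rfl fun n _ => ?_
  rw [integral_const_mul, h.integral_norm_iteratedDeriv_sq n, ← integral_const_mul]
  congr 1 with s
  have : Real.pi ^ (2 * n) ≠ 0 := by positivity
  rw [← pow_mul, mul_right_comm 2 Real.pi s, mul_pow (2 * s)]
  field_simp

end IsBandFun

/-! ### The extremal density and the quadratic functional. -/

theorem continuous_polyFun (N : ℕ) (a : ℕ → ℝ) : Continuous (polyFun N a) := by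
  unfold polyFun
  fun_prop

/-- The density `s ↦ (I * P(4 s²))⁻¹` on `[-1/2, 1/2]` of the extremal function, where
`I = recipIntegral N a`. -/
noncomputable def extremalDensity (N : ℕ) (a : ℕ → ℝ) : ℝ → ℂ :=
  (Icc (-(1 / 2) : ℝ) (1 / 2)).indicator fun s =>
    (((recipIntegral N a)⁻¹ * (1 / polyFun N a ((2 * s) ^ 2)) : ℝ) : ℂ)

section

variable {N : ℕ} {a : ℕ → ℝ}

theorem sq_mem_Icc_zero_one {t : ℝ} (ht : t ∈ Icc (-1 : ℝ) 1) : t ^ 2 ∈ Icc (0 : ℝ) 1 :=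
  ⟨sq_nonneg t, by nlinarith [ht.1, ht.2]⟩

theorem two_mul_mem_Icc {s : ℝ} (hs : s ∈ Icc (-(1 / 2) : ℝ) (1 / 2)) :
    2 * s ∈ Icc (-1 : ℝ) 1 :=
  ⟨by linarith [hs.1], by linarith [hs.2]⟩

theorem continuousOn_one_div_polyFun_sq (hpos : ∀ x ∈ Icc (0 : ℝ) 1, 0 < polyFun N a x) :
    ContinuousOn (fun t : ℝ => 1 / polyFun N a (t ^ 2)) (Icc (-1) 1) :=
  continuousOn_const.div ((continuous_polyFun N a).comp (by fun_prop)).continuousOn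
    fun t ht => (hpos _ (sq_mem_Icc_zero_one ht)).ne'

theorem recipIntegral_pos (hpos : ∀ x ∈ Icc (0 : ℝ) 1, 0 < polyFun N a x) :
    0 < recipIntegral N a := by
  refine intervalIntegral.intervalIntegral_pos_of_pos_on ?_ (fun t ht => ?_) one_pos
  · refine ContinuousOn.intervalIntegrable_of_Icc zero_le_one
      ((continuousOn_one_div_polyFun_sq hpos).mono (Icc_subset_Icc_left (by norm_num)))
  · exact one_div_pos.2 (hpos _ (sq_mem_Icc_zero_one ⟨by linarith [ht.1], ht.2.le⟩))

theorem isBandFun_extremalDensity (hpos : ∀ x ∈ Icc (0 : ℝ) 1, 0 < polyFun N a x) :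
    IsBandFun (extremalDensity N a) := by
  refine ⟨?_, fun s hs => indicator_of_notMem hs _⟩
  refine (memLp_indicator_iff_restrict measurableSet_Icc).2 ?_
  have hc : ContinuousOn (fun s : ℝ =>
      (((recipIntegral N a)⁻¹ * (1 / polyFun N a ((2 * s) ^ 2)) : ℝ) : ℂ))
      (Icc (-(1 / 2)) (1 / 2)) :=
    Complex.continuous_ofReal.comp_continuousOn (continuousOn_const.mul
      ((continuousOn_one_div_polyFun_sq hpos).comp (by fun_prop) fun s hs => two_mul_mem_Icc hs))
  obtain ⟨C, hC⟩ := isCompact_Icc.exists_bound_of_continuousOn hc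
  exact MemLp.of_bound (hc.aestronglyMeasurable measurableSet_Icc) C
    ((ae_restrict_iff' measurableSet_Icc).2 (Eventually.of_forall hC))

/-- The extremal function is the Fourier–Laplace transform of `extremalDensity`. -/
theorem fourierLaplace_extremalDensity (hpos : ∀ x ∈ Icc (0 : ℝ) 1, 0 < polyFun N a x) :
    fourierLaplace (extremalDensity N a) = extremalFun N a := by
  ext z
  set q : ℝ → ℂ := fun t => ((1 / polyFun N a (t ^ 2) : ℝ) : ℂ) with hq
  have hqc : ContinuousOn q (Icc (-1) 1) :=
    Complex.continuous_ofReal.comp_continuousOn (continuousOn_one_div_polyFun_sq hpos)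
  set E : ℝ → ℂ := fun t => q t * Complex.exp (Real.pi * Complex.I * z * t) with hE
  have hEc : ContinuousOn E (Icc (-1) 1) := hqc.mul (by fun_prop)
  have h1 : fourierLaplace (extremalDensity N a) z =
      ((recipIntegral N a : ℝ) : ℂ)⁻¹ * ∫ s in (-(1 / 2) : ℝ)..(1 / 2), E (2 * s) := by
    rw [fourierLaplace, intervalIntegral.integral_of_le (by norm_num), ← integral_Icc_eq_integral_Ioc,
      ← integral_const_mul, ← integral_indicator measurableSet_Icc]
    congr 1 with s
    by_cases hs : s ∈ Icc (-(1 / 2) : ℝ) (1 / 2)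
    · rw [extremalDensity, indicator_of_mem hs, indicator_of_mem hs, hE, hq]
      push_cast
      ring_nf
    · rw [extremalDensity, indicator_of_notMem hs, indicator_of_notMem hs, zero_mul]
  have h2 : ∫ s in (-(1 / 2) : ℝ)..(1 / 2), E (2 * s) = (1 / 2 : ℂ) * ∫ t in (-1 : ℝ)..1, E t := by
    rw [intervalIntegral.integral_comp_mul_left E (two_ne_zero)]
    norm_num
  have i1 : IntervalIntegrable E volume (-1) 0 :=
    (hEc.mono (Icc_subset_Icc_right zero_le_one)).intervalIntegrable_of_Icc (by norm_num)
  have i2 : IntervalIntegrable E volume 0 1 :=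
    (hEc.mono (Icc_subset_Icc_left (by norm_num))).intervalIntegrable_of_Icc (by norm_num)
  have i3 : IntervalIntegrable (fun t => E (-t)) volume 0 1 := by
    refine ContinuousOn.intervalIntegrable_of_Icc zero_le_one (hEc.comp (by fun_prop) ?_)
    intro t ht
    exact ⟨by linarith [ht.2], by linarith [ht.1]⟩
  -- Since `P(t²)` is even, folding `[-1, 0]` onto `[0, 1]` pairs the exponentials into a cosine;
  -- the `1/2` from `t = 2s` is the one in its definition.
  have h3 : ∫ t in (-1 : ℝ)..0, E t = ∫ t in (0 : ℝ)..1, E (-t) := by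
    rw [intervalIntegral.integral_comp_neg]
    simp
  rw [h1, h2, ← intervalIntegral.integral_add_adjacent_intervals i1 i2, h3,
    ← intervalIntegral.integral_add i3 i2, extremalFun, ← intervalIntegral.integral_const_mul]
  congr 2 with t
  simp only [hE, hq, Complex.cos, neg_sq]
  push_cast
  have e1 : (Real.pi : ℂ) * z * t * Complex.I = Real.pi * Complex.I * z * t := by ring
  have e2 : -((Real.pi : ℂ) * z * t) * Complex.I = Real.pi * Complex.I * z * -t := by ring
  rw [e1, e2]
  ring

theorem extremalFun_zero (hpos : ∀ x ∈ Icc (0 : ℝ) 1, 0 < polyFun N a x) :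
    extremalFun N a 0 = 1 := by
  have h0 : ((recipIntegral N a : ℝ) : ℂ) ≠ 0 :=
    Complex.ofReal_ne_zero.2 (recipIntegral_pos hpos).ne'
  have : ∫ t in (0 : ℝ)..1, Complex.cos ((Real.pi : ℂ) * 0 * (t : ℂ)) /
      ((polyFun N a (t ^ 2) : ℝ) : ℂ) = ((recipIntegral N a : ℝ) : ℂ) := by
    rw [recipIntegral, ← intervalIntegral.integral_ofReal]
    simp
  rw [extremalFun, this, inv_mul_cancel₀ h0]

theorem fourierLaplace_zero (φ : ℝ → ℂ) : fourierLaplace φ 0 = ∫ s, φ s := by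
  simp [fourierLaplace]

/-- Completing the square in the quadratic functional. -/
theorem integral_norm_sq_mul_polyFun {φ : ℝ → ℂ} (hφ : IsBandFun φ) (h1 : ∫ s, φ s = 1)
    (hpos : ∀ x ∈ Icc (0 : ℝ) 1, 0 < polyFun N a x) :
    ∫ s, ‖φ s‖ ^ 2 * polyFun N a ((2 * s) ^ 2) = (recipIntegral N a)⁻¹ +
      ∫ s, ‖φ s - extremalDensity N a s‖ ^ 2 * polyFun N a ((2 * s) ^ 2) := by
  have hI := recipIntegral_pos hpos
  have hψ := isBandFun_extremalDensity hpos
  have hψ1 : ∫ s, extremalDensity N a s = 1 := by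
    rw [← fourierLaplace_zero, fourierLaplace_extremalDensity hpos, extremalFun_zero hpos]
  have hpc : Continuous fun s : ℝ => polyFun N a ((2 * s) ^ 2) :=
    (continuous_polyFun N a).comp (by fun_prop)
  -- On the band `ψ P = 1/I`, so the cross term is linear in `φ` and `|ψ|² P = ψ / I`; both
  -- integrate to known values.
  have hpt : ∀ s, ‖φ s - extremalDensity N a s‖ ^ 2 * polyFun N a ((2 * s) ^ 2) =
      ‖φ s‖ ^ 2 * polyFun N a ((2 * s) ^ 2) - 2 * (recipIntegral N a)⁻¹ * (φ s).re +
        (recipIntegral N a)⁻¹ * (extremalDensity N a s).re := by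
    intro s
    by_cases hs : s ∈ Icc (-(1 / 2) : ℝ) (1 / 2)
    · have hP := hpos _ (sq_mem_Icc_zero_one (two_mul_mem_Icc hs))
      rw [extremalDensity, indicator_of_mem hs, Complex.sq_norm, Complex.sq_norm,
        Complex.normSq_apply, Complex.normSq_apply]
      simp only [Complex.sub_re, Complex.sub_im, Complex.ofReal_re, Complex.ofReal_im]
      generalize polyFun N a ((2 * s) ^ 2) = P at hP ⊢
      field_simp
      ring
    · rw [hψ.eq_zero s hs, hφ.eq_zero s hs]
      simp
  have hre : ∀ {f : ℝ → ℂ}, Integrable f → ∫ s, f s = 1 → ∫ s, (f s).re = 1 := by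
    intro f hf hf1
    have := integral_re (𝕜 := ℂ) hf
    rw [hf1] at this
    simpa using this
  have i1 := hφ.integrable_norm_sq_mul hpc
  have i2 : Integrable fun s => 2 * (recipIntegral N a)⁻¹ * (φ s).re :=
    hφ.integrable.re.const_mul _
  have i3 : Integrable fun s => (recipIntegral N a)⁻¹ * (extremalDensity N a s).re :=
    hψ.integrable.re.const_mul _
  have i12 : Integrable fun s => ‖φ s‖ ^ 2 * polyFun N a ((2 * s) ^ 2) -
      2 * (recipIntegral N a)⁻¹ * (φ s).re := i1.sub i2
  simp_rw [hpt]
  rw [integral_add i12 i3, integral_sub i1 i2, integral_const_mul, integral_const_mul,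
    hre hφ.integrable h1, hre hψ.integrable hψ1]
  ring

/-- Outside the band `P` may be negative, but there both densities vanish. -/
theorem norm_sub_sq_mul_polyFun_nonneg {φ ψ : ℝ → ℂ} (hφ : IsBandFun φ) (hψ : IsBandFun ψ)
    (hpos : ∀ x ∈ Icc (0 : ℝ) 1, 0 < polyFun N a x) (s : ℝ) :
    0 ≤ ‖φ s - ψ s‖ ^ 2 * polyFun N a ((2 * s) ^ 2) := by
  by_cases hs : s ∈ Icc (-(1 / 2) : ℝ) (1 / 2)
  · have hP := hpos _ (sq_mem_Icc_zero_one (two_mul_mem_Icc hs))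
    positivity
  · simp [hφ.eq_zero s hs, hψ.eq_zero s hs]

theorem ae_eq_of_integral_norm_sub_sq_mul_polyFun_eq_zero {φ ψ : ℝ → ℂ} (hφ : IsBandFun φ)
    (hψ : IsBandFun ψ) (hpos : ∀ x ∈ Icc (0 : ℝ) 1, 0 < polyFun N a x)
    (h : ∫ s, ‖φ s - ψ s‖ ^ 2 * polyFun N a ((2 * s) ^ 2) = 0) : φ =ᵐ[volume] ψ := by
  have hpc : Continuous fun s : ℝ => polyFun N a ((2 * s) ^ 2) :=
    (continuous_polyFun N a).comp (by fun_prop)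
  rw [integral_eq_zero_iff_of_nonneg (norm_sub_sq_mul_polyFun_nonneg hφ hψ hpos)
    ((hφ.sub hψ).integrable_norm_sq_mul hpc)] at h
  filter_upwards [h] with s hs
  by_cases hs' : s ∈ Icc (-(1 / 2) : ℝ) (1 / 2)
  · have hP := hpos _ (sq_mem_Icc_zero_one (two_mul_mem_Icc hs'))
    have : ‖φ s - ψ s‖ ^ 2 * polyFun N a ((2 * s) ^ 2) = 0 := hs
    simpa [hP.ne', sub_eq_zero] using this
  · rw [hφ.eq_zero s hs', hψ.eq_zero s hs']

end

/-! ### Gaussian regularization and Plancherel on horizontal lines. -/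

theorem eq_of_eq_on_real {f g : ℂ → ℂ} (hf : Differentiable ℂ f) (hg : Differentiable ℂ g)
    (h : ∀ x : ℝ, f x = g x) : f = g := by
  refine AnalyticOnNhd.eq_of_frequently_eq (z₀ := 0) (fun z _ => hf.analyticAt z)
    (fun z _ => hg.analyticAt z) ?_
  have hu : Tendsto (fun n : ℕ => (((1 / ((n : ℝ) + 1) : ℝ)) : ℂ)) atTop (𝓝[≠] 0) := by
    refine tendsto_nhdsWithin_iff.2 ⟨?_, Eventually.of_forall fun n => ?_⟩
    · exact (Complex.continuous_ofReal.tendsto' 0 0 Complex.ofReal_zero).comp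
        tendsto_one_div_add_atTop_nhds_zero_nat
    · have : (1 / ((n : ℝ) + 1)) ≠ 0 := by positivity
      exact Complex.ofReal_ne_zero.2 this
  exact hu.frequently (Frequently.of_forall fun n => h _)

theorem integrable_exp_mul_abs_sub_mul_sq {b : ℝ} (hb : 0 < b) (c : ℝ) :
    Integrable fun x : ℝ => Real.exp (c * |x| - b * x ^ 2) := by
  have key : ∀ c : ℝ, Integrable fun x : ℝ => Real.exp (c * x - b * x ^ 2) := by
    intro c
    have := (integrable_cexp_quadratic (b := (b : ℂ)) (by simpa using hb) (c : ℂ) 0).norm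
    refine this.congr (Eventually.of_forall fun x => ?_)
    simp only [Complex.norm_exp]
    congr 1
    have : -(b : ℂ) * (x : ℂ) ^ 2 + c * x + 0 = ((c * x - b * x ^ 2 : ℝ) : ℂ) := by
      push_cast; ring
    rw [this, Complex.ofReal_re]
  refine ((key c).add (key (-c))).mono' (by fun_prop : Continuous _).aestronglyMeasurable
    (Eventually.of_forall fun x => ?_)
  rw [Real.norm_of_nonneg (Real.exp_nonneg _)]
  change _ ≤ Real.exp (c * x - b * x ^ 2) + Real.exp (-c * x - b * x ^ 2)
  rcases abs_cases x with ⟨h, _⟩ | ⟨h, _⟩ <;> rw [h]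
  · linarith [Real.exp_pos (-c * x - b * x ^ 2)]
  · rw [mul_neg, ← neg_mul]
    linarith [Real.exp_pos (c * x - b * x ^ 2)]

theorem memLp_two_exp_mul_abs_sub_mul_sq {b : ℝ} (hb : 0 < b) (c : ℝ) :
    MemLp (fun x : ℝ => Real.exp (c * |x| - b * x ^ 2)) 2 := by
  rw [memLp_two_iff_integrable_sq (by fun_prop : Continuous _).aestronglyMeasurable]
  refine (integrable_exp_mul_abs_sub_mul_sq (b := 2 * b) (by positivity) (2 * c)).congr
    (Eventually.of_forall fun x => ?_)
  simp only [pow_two, ← Real.exp_add]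
  ring_nf

/-- Convolution with the Gaussian `exp (-π x²)`. -/
noncomputable def gaussConv (g : ℂ → ℂ) (z : ℂ) : ℂ :=
  ∫ x : ℝ, g (x + z) * Real.exp (-Real.pi * x ^ 2)

theorem norm_gaussConv_integrand_le {g : ℂ → ℂ} {C τ : ℝ} (hC : 0 < C) (hτ : 0 ≤ τ)
    (h : ∀ z, ‖g z‖ ≤ C * Real.exp (τ * ‖z‖)) (z : ℂ) (x : ℝ) :
    ‖g (x + z) * Real.exp (-Real.pi * x ^ 2)‖ ≤
      C * Real.exp (τ * |x| - Real.pi * x ^ 2) * Real.exp (τ * ‖z‖) := by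
  have h1 : ‖(x : ℂ) + z‖ ≤ |x| + ‖z‖ := (norm_add_le _ _).trans (by simp)
  rw [norm_mul, Complex.norm_real, Real.norm_of_nonneg (Real.exp_nonneg _)]
  calc ‖g (x + z)‖ * Real.exp (-Real.pi * x ^ 2)
      ≤ C * Real.exp (τ * (|x| + ‖z‖)) * Real.exp (-Real.pi * x ^ 2) := by
        gcongr
        exact (h _).trans (by gcongr)
    _ = _ := by
        rw [mul_assoc, ← Real.exp_add, mul_assoc, ← Real.exp_add]
        ring_nf

theorem differentiable_gaussConv {g : ℂ → ℂ} (hg : Differentiable ℂ g) {τ : ℝ} (hτ : 0 ≤ τ)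
    (ht : HasExpTypeAtMost g τ) : Differentiable ℂ (gaussConv g) := by
  obtain ⟨C, hC, h⟩ := ht 1 one_pos
  refine differentiable_integral_of_dominated (fun z => ?_) (fun x => ?_) (fun R => ?_)
  · have := hg.continuous
    exact (by fun_prop : Continuous _).aestronglyMeasurable
  · exact (hg.comp (by fun_prop : Differentiable ℂ fun z : ℂ => (x : ℂ) + z)).mul_const _
  · refine ⟨fun x => C * Real.exp ((τ + 1) * |x| - Real.pi * x ^ 2) * Real.exp ((τ + 1) * R),
      ((integrable_exp_mul_abs_sub_mul_sq Real.pi_pos _).const_mul _).mul_const _,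
      fun z hz x => (norm_gaussConv_integrand_le hC (by positivity) h z x).trans ?_⟩
    exact mul_le_mul_of_nonneg_left (Real.exp_le_exp.2 (by gcongr)) (by positivity)

theorem hasExpTypeAtMost_gaussConv {g : ℂ → ℂ} {τ : ℝ} (hτ : 0 ≤ τ)
    (ht : HasExpTypeAtMost g τ) : HasExpTypeAtMost (gaussConv g) τ := by
  intro ε hε
  obtain ⟨C, hC, h⟩ := ht ε hε
  have hint := integrable_exp_mul_abs_sub_mul_sq Real.pi_pos (τ + ε)
  refine ⟨C * (∫ x : ℝ, Real.exp ((τ + ε) * |x| - Real.pi * x ^ 2)),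
    mul_pos hC (integral_exp_pos hint), fun z => ?_⟩
  rw [← integral_const_mul, ← integral_mul_const]
  exact norm_integral_le_of_norm_le ((hint.const_mul _).mul_const _)
    (Eventually.of_forall (norm_gaussConv_integrand_le hC (by positivity) h z))

section

variable {φ : ℝ → ℂ}

theorem norm_mul_gauss_mul_exp_le (z : ℂ) (s : ℝ) :
    ‖φ s * Real.exp (-Real.pi * s ^ 2) * Complex.exp (2 * Real.pi * Complex.I * z * s)‖ ≤
      ‖φ s‖ * Real.exp (2 * Real.pi * ‖z‖ * |s| - Real.pi * s ^ 2) := by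
  rw [norm_mul, norm_mul, Complex.norm_real, Real.norm_of_nonneg (Real.exp_nonneg _),
    Complex.norm_exp, mul_assoc, ← Real.exp_add]
  gcongr
  have : (2 * Real.pi * Complex.I * z * s).re ≤ 2 * Real.pi * ‖z‖ * |s| := by
    refine (Complex.re_le_norm _).trans_eq ?_
    simp [abs_of_pos Real.pi_pos]
  linarith

theorem aestronglyMeasurable_mul_gauss_mul_exp (hφ : MemLp φ 2) (z : ℂ) :
    AEStronglyMeasurable (fun s : ℝ => φ s * Real.exp (-Real.pi * s ^ 2) *
      Complex.exp (2 * Real.pi * Complex.I * z * s)) volume :=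
  (hφ.1.mul (by fun_prop : Continuous _).aestronglyMeasurable).mul
    (by fun_prop : Continuous _).aestronglyMeasurable

theorem integrable_norm_mul_exp (hφ : MemLp φ 2) (c : ℝ) :
    Integrable fun s => ‖φ s‖ * Real.exp (c * |s| - Real.pi * s ^ 2) :=
  hφ.norm.integrable_mul (memLp_two_exp_mul_abs_sub_mul_sq Real.pi_pos c)

theorem integrable_mul_gauss_mul_exp (hφ : MemLp φ 2) (z : ℂ) :
    Integrable fun s : ℝ => φ s * Real.exp (-Real.pi * s ^ 2) *
      Complex.exp (2 * Real.pi * Complex.I * z * s) :=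
  (integrable_norm_mul_exp hφ _).mono' (aestronglyMeasurable_mul_gauss_mul_exp hφ z)
    (Eventually.of_forall (norm_mul_gauss_mul_exp_le z))

theorem memLp_mul_gauss_mul_exp (hφ : MemLp φ 2) (z : ℂ) :
    MemLp (fun s : ℝ => φ s * Real.exp (-Real.pi * s ^ 2) *
      Complex.exp (2 * Real.pi * Complex.I * z * s)) 2 := by
  refine hφ.of_le_mul (c := Real.exp (Real.pi * ‖z‖ ^ 2))
    (aestronglyMeasurable_mul_gauss_mul_exp hφ z) (Eventually.of_forall fun s => ?_)
  rw [mul_comm (Real.exp _)]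
  refine (norm_mul_gauss_mul_exp_le z s).trans ?_
  gcongr
  -- This square yields `2π‖z‖|s| - πs² ≤ π‖z‖²`, the origin of the constant `exp(π‖z‖²)`.
  have : 0 ≤ Real.pi * (‖z‖ - |s|) ^ 2 := by positivity
  rw [← sq_abs s]
  linarith [this, (by ring : Real.pi * (‖z‖ - |s|) ^ 2 =
    Real.pi * ‖z‖ ^ 2 - 2 * Real.pi * ‖z‖ * |s| + Real.pi * |s| ^ 2)]

theorem differentiable_fourierLaplace_mul_gauss (hφ : MemLp φ 2) :
    Differentiable ℂ (fourierLaplace fun s => φ s * Real.exp (-Real.pi * s ^ 2)) := by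
  refine differentiable_integral_of_dominated (aestronglyMeasurable_mul_gauss_mul_exp hφ)
    (fun s => by fun_prop) (fun R => ⟨_, integrable_norm_mul_exp hφ (2 * Real.pi * R),
      fun z hz s => (norm_mul_gauss_mul_exp_le z s).trans ?_⟩)
  have := Real.pi_pos
  gcongr

/-- Moving to height `y` only multiplies the density by `exp(-2πys)`, which makes Plancherel
available on every horizontal line. -/
theorem fourierLaplace_horizontal (ψ : ℝ → ℂ) (x y : ℝ) :
    fourierLaplace ψ (x + y * Complex.I) =
      𝓕⁻ (fun s : ℝ => ψ s * Complex.exp (2 * Real.pi * Complex.I * (y * Complex.I) * s)) x := by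
  rw [← fourierLaplace_ofReal, fourierLaplace, fourierLaplace]
  congr 1 with s
  rw [mul_assoc (ψ s), ← Complex.exp_add]
  ring_nf

theorem memLp_fourierLaplace_horizontal (hφ : MemLp φ 2) (y : ℝ) :
    MemLp (fun x : ℝ => fourierLaplace (fun s => φ s * Real.exp (-Real.pi * s ^ 2))
      (x + y * Complex.I)) 2 := by
  simp only [fourierLaplace_horizontal]
  exact memLp_fourierInv (integrable_mul_gauss_mul_exp hφ _) (memLp_mul_gauss_mul_exp hφ _)

theorem norm_mul_gauss_mul_exp_sq (y s : ℝ) :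
    ‖φ s * Real.exp (-Real.pi * s ^ 2) *
      Complex.exp (2 * Real.pi * Complex.I * (y * Complex.I) * s)‖ ^ 2 =
    ‖φ s * Real.exp (-Real.pi * s ^ 2)‖ ^ 2 * Real.exp (-4 * Real.pi * y * s) := by
  have : 2 * Real.pi * Complex.I * (y * Complex.I) * s = ((-2 * Real.pi * y * s : ℝ) : ℂ) := by
    push_cast
    linear_combination (2 * Real.pi * y * s : ℂ) * Complex.I_mul_I
  rw [norm_mul, mul_pow, this, Complex.norm_exp, Complex.ofReal_re, ← Real.exp_nat_mul]
  congr 2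
  push_cast
  ring

theorem integrable_gauss_weight (hφ : MemLp φ 2) (y : ℝ) :
    Integrable fun s : ℝ =>
      ‖φ s * Real.exp (-Real.pi * s ^ 2)‖ ^ 2 * Real.exp (-4 * Real.pi * y * s) := by
  simp only [← norm_mul_gauss_mul_exp_sq]
  exact (memLp_mul_gauss_mul_exp hφ _).integrable_norm_pow (by norm_num)

theorem integral_norm_fourierLaplace_horizontal_sq (hφ : MemLp φ 2) (y : ℝ) :
    ∫ x : ℝ, ‖fourierLaplace (fun s => φ s * Real.exp (-Real.pi * s ^ 2))
      (x + y * Complex.I)‖ ^ 2 =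
    ∫ s : ℝ, ‖φ s * Real.exp (-Real.pi * s ^ 2)‖ ^ 2 * Real.exp (-4 * Real.pi * y * s) := by
  simp only [fourierLaplace_horizontal, ← norm_mul_gauss_mul_exp_sq]
  exact integral_norm_fourierInv_sq (integrable_mul_gauss_mul_exp hφ _)
    (memLp_mul_gauss_mul_exp hφ _)

end

/-- Plancherel: on the real line, Gaussian convolution multiplies the Fourier transform by the
Gaussian. -/
theorem gaussConv_ofReal {g : ℂ → ℂ} (hg : MemLp (fun x : ℝ => g x) 2) (t : ℝ) :
    gaussConv g t = fourierLaplace (fun s : ℝ =>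
      (𝓕 (hg.toLp _) : Lp (α := ℝ) ℂ 2 volume) s * Real.exp (-Real.pi * s ^ 2)) t := by
  -- The inverse transform of `v` is the Gaussian centred at `t`, so both sides of the claim are
  -- `L²` inner products, equal by Parseval.
  set v : ℝ → ℂ := fun s => 1 * Real.exp (-Real.pi * s ^ 2) *
    Complex.exp (2 * Real.pi * Complex.I * (-t : ℂ) * s) with hv
  have hvle : ∀ s, ‖v s‖ ≤ Real.exp (2 * Real.pi * ‖(-t : ℂ)‖ * |s| - Real.pi * s ^ 2) := fun s => by
    refine (norm_mul_gauss_mul_exp_le (φ := fun _ => 1) (-t : ℂ) s).trans_eq ?_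
    simp
  have hvc : Continuous v := by fun_prop
  have hv1 : Integrable v := (integrable_exp_mul_abs_sub_mul_sq Real.pi_pos _).mono'
    hvc.aestronglyMeasurable (Eventually.of_forall hvle)
  have hv2 : MemLp v 2 := (memLp_two_exp_mul_abs_sub_mul_sq Real.pi_pos _).mono'
    hvc.aestronglyMeasurable (Eventually.of_forall hvle)
  have hFv : 𝓕⁻ v = fun x : ℝ => (Real.exp (-Real.pi * (x - t) ^ 2) : ℂ) := by
    have hvg : v = fun s : ℝ => Complex.exp (-Real.pi * 1 * s ^ 2 +
        2 * Real.pi * (-t * Complex.I) * s) := by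
      ext s
      simp only [hv]
      push_cast
      rw [one_mul, ← Complex.exp_add]
      ring_nf
    ext x
    rw [Real.fourierInv_eq_fourier_neg, hvg, fourier_gaussian_pi' (by simp)]
    simp only [Complex.one_cpow, div_one, one_mul]
    push_cast
    congr 2
    have : Complex.I * (-(t : ℂ) * Complex.I) = t := by
      linear_combination (-(t : ℂ)) * Complex.I_mul_I
    rw [this]
    ring
  set G : Lp (α := ℝ) ℂ 2 volume := hg.toLp (fun x : ℝ => g x) with hG
  have hinner := Lp.inner_fourier_eq (𝓕⁻ (hv2.toLp v)) G
  rw [FourierTransform.fourier_fourierInv_eq, L2.inner_def, L2.inner_def] at hinner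
  have hl : ∫ s, inner ℂ ((hv2.toLp v) s) ((𝓕 G : Lp (α := ℝ) ℂ 2 volume) s) =
      fourierLaplace (fun s : ℝ =>
      (𝓕 G : Lp (α := ℝ) ℂ 2 volume) s * Real.exp (-Real.pi * s ^ 2)) t := by
    refine integral_congr_ae ?_
    filter_upwards [hv2.coeFn_toLp] with s hs
    rw [hs, RCLike.inner_apply, mul_assoc]
    congr 1
    simp only [hv, map_mul, Complex.conj_ofReal, ← Complex.exp_conj]
    simp [Complex.conj_ofNat]
  have hr : ∫ x, inner ℂ ((𝓕⁻ (hv2.toLp v) : Lp (α := ℝ) ℂ 2 volume) x) (G x) = gaussConv g t := by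
    calc _ = ∫ x : ℝ, g x * Real.exp (-Real.pi * (x - t) ^ 2) := by
          refine integral_congr_ae ?_
          filter_upwards [fourierInv_toLp_ae_eq hv1 hv2, hg.coeFn_toLp] with x hx hx'
          rw [hx, hx', hFv, RCLike.inner_apply, Complex.conj_ofReal]
      _ = _ := by
          rw [← integral_add_right_eq_self _ t]
          simp [gaussConv]
  rw [← hl, ← hr, hinner]

/-! ### From exponential type to compact spectrum: the Paley–Wiener theorem. -/

theorem norm_integral_mul_le_sqrt {μ : Measure ℝ} {u v : ℝ → ℂ} (hu : MemLp u 2 μ)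
    (hv : MemLp v 2 μ) :
    ‖∫ t, u t * v t ∂μ‖ ≤ √(∫ t, ‖u t‖ ^ 2 ∂μ) * √(∫ t, ‖v t‖ ^ 2 ∂μ) := by
  have h2 : ENNReal.ofReal 2 = 2 := by norm_num
  have := integral_mul_norm_le_Lp_mul_Lq (μ := μ) (f := u) (g := v) Real.HolderConjugate.two_two
    (by rwa [h2]) (by rwa [h2])
  simp only [Real.rpow_two, ← Real.sqrt_eq_rpow] at this
  refine (norm_integral_le_integral_norm _).trans ?_
  simpa only [norm_mul] using this

/-- The `L²` norm of a function of exponential type `τ` on the horizontal line of height `y` is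
at most `exp (τ |y|)` times its `L²` norm on the real line. -/
theorem HasExpTypeAtMost.integral_horizontal_le {H : ℂ → ℂ} {τ : ℝ} (hτ : 0 ≤ τ)
    (hH : Differentiable ℂ H) (htype : HasExpTypeAtMost H τ)
    (h2 : MemLp (fun x : ℝ => H x) 2) (y : ℝ)
    (hy : MemLp (fun x : ℝ => H (x + y * Complex.I)) 2) :
    ∫ x : ℝ, ‖H (x + y * Complex.I)‖ ^ 2 ≤
      Real.exp (2 * τ * |y|) * ∫ x : ℝ, ‖H x‖ ^ 2 := by
  have hHc := hH.continuous
  set B : ℝ := ∫ x : ℝ, ‖H x‖ ^ 2 with hB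
  have hB0 : 0 ≤ B := integral_nonneg fun x => by positivity
  have key : ∀ n : ℕ, ∫ t in Icc (-(n : ℝ)) n, ‖H (t + y * Complex.I)‖ ^ 2 ≤
      Real.exp (2 * τ * |y|) * B := by
    intro n
    set μ : Measure ℝ := volume.restrict (Icc (-(n : ℝ)) n) with hμ
    set A : ℝ := ∫ t, ‖H (t + y * Complex.I)‖ ^ 2 ∂μ with hA
    have hA0 : 0 ≤ A := integral_nonneg fun x => by positivity
    set u : ℝ → ℂ := fun t => (starRingEnd ℂ) (H (t + y * Complex.I)) with hu
    have huc : Continuous u := by fun_prop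
    have hunorm : ∀ t, ‖u t‖ = ‖H (t + y * Complex.I)‖ := fun t => RCLike.norm_conj _
    -- `u` cut off outside of `[-n, n]`, so that bounds hold everywhere
    set w : ℝ → ℂ := (Icc (-(n : ℝ)) n).indicator u with hw
    have hwint : Integrable w :=
      (integrable_indicator_iff measurableSet_Icc).2 (huc.continuousOn.integrableOn_Icc)
    have hw2 : MemLp w 2 := by
      refine MemLp.indicator measurableSet_Icc ?_
      exact (memLp_congr_norm huc.aestronglyMeasurable hy.1
        (Eventually.of_forall hunorm)).2 hy
    have hwA : ∫ t, ‖w t‖ ^ 2 = A := by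
      rw [hA, hμ, ← integral_indicator measurableSet_Icc]
      congr 1 with t
      by_cases ht : t ∈ Icc (-(n : ℝ)) n
      · rw [hw, indicator_of_mem ht, indicator_of_mem ht, hunorm]
      · rw [hw, indicator_of_notMem ht, indicator_of_notMem ht]
        simp
    -- Duality reduces the `L²` bound to a sup bound: Cauchy–Schwarz gives `|k| ≤ √B √A` on the real
    -- line, while `k(iy) = A`. The Phragmén–Lindelöf bound then reads `A ≤ √B √A exp(τ|y|)`.
    set k : ℂ → ℂ := fun z => ∫ t : ℝ, H (t + z) * w t with hk
    have hbd : ∀ {C σ : ℝ}, 0 < C → 0 ≤ σ → (∀ z, ‖H z‖ ≤ C * Real.exp (σ * ‖z‖)) →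
        ∀ (z : ℂ) (t : ℝ), ‖H (t + z) * w t‖ ≤
          C * Real.exp (σ * n) * Real.exp (σ * ‖z‖) * ‖w t‖ := by
      intro C σ hC hσ h z t
      by_cases ht : t ∈ Icc (-(n : ℝ)) n
      · rw [norm_mul]
        gcongr
        refine (h _).trans ?_
        rw [mul_assoc, ← Real.exp_add, ← mul_add]
        gcongr
        refine (norm_add_le _ _).trans ?_
        gcongr
        simpa using abs_le.2 ⟨ht.1, ht.2⟩
      · rw [hw, indicator_of_notMem ht]
        simp
    have hkd : Differentiable ℂ k := by
      obtain ⟨C, hC, h⟩ := htype 1 one_pos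
      refine differentiable_integral_of_dominated (fun z => ?_) (fun t => ?_) (fun R => ?_)
      · exact (by fun_prop : Continuous fun t : ℝ => H (t + z)).aestronglyMeasurable.mul hwint.1
      · exact (hH.comp (by fun_prop : Differentiable ℂ fun z : ℂ => (t : ℂ) + z)).mul_const _
      · refine ⟨_, hwint.norm.const_mul (C * Real.exp ((τ + 1) * n) * Real.exp ((τ + 1) * R)),
          fun z hz t => (hbd hC (by positivity) h z t).trans ?_⟩
        have : Real.exp ((τ + 1) * ‖z‖) ≤ Real.exp ((τ + 1) * R) := by gcongr
        gcongr
    have hktype : HasExpTypeAtMost k τ := by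
      intro ε hε
      obtain ⟨C, hC, h⟩ := htype ε hε
      have h0 : 0 ≤ ∫ t, ‖w t‖ := integral_nonneg fun t => norm_nonneg _
      refine ⟨C * Real.exp ((τ + ε) * n) * ((∫ t, ‖w t‖) + 1), by positivity, fun z => ?_⟩
      have := norm_integral_le_of_norm_le
        (hwint.norm.const_mul (C * Real.exp ((τ + ε) * n) * Real.exp ((τ + ε) * ‖z‖)))
        (Eventually.of_forall (hbd hC (by positivity) h z))
      rw [integral_const_mul] at this
      refine this.trans ?_
      rw [mul_assoc _ ((∫ t, ‖w t‖) + 1), mul_comm ((∫ t, ‖w t‖) + 1), ← mul_assoc]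
      gcongr
      linarith
    have hkreal : ∀ x : ℝ, ‖k x‖ ≤ √B * √A := by
      intro x
      have hx : MemLp (fun t : ℝ => H (t + x)) 2 := by
        simpa [Function.comp_def] using
          h2.comp_measurePreserving (measurePreserving_add_right volume x)
      have := norm_integral_mul_le_sqrt hx hw2
      rw [hwA] at this
      have hBx : ∫ t : ℝ, ‖H (t + x)‖ ^ 2 = B := by
        have := integral_add_right_eq_self (μ := volume) (fun t : ℝ => ‖H t‖ ^ 2) x
        simpa using this
      rwa [hBx] at this
    have hkI : k (y * Complex.I) = A := by
      rw [hk, hA, ← integral_complex_ofReal, hμ, ← integral_indicator measurableSet_Icc]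
      refine integral_congr_ae (Eventually.of_forall fun t => ?_)
      beta_reduce
      by_cases ht : t ∈ Icc (-(n : ℝ)) n
      · rw [hw, indicator_of_mem ht, indicator_of_mem ht, hu, RCLike.mul_conj]
        norm_cast
      · rw [hw, indicator_of_notMem ht, indicator_of_notMem ht, mul_zero]
    have hPL := hktype.norm_le hkd hkreal (y * Complex.I)
    rw [hkI, Complex.norm_real, Real.norm_of_nonneg hA0] at hPL
    have him : (y * Complex.I).im = y := by simp
    rw [him] at hPL
    have hsq : √A ≤ √B * Real.exp (τ * |y|) := by
      rcases eq_or_lt_of_le (Real.sqrt_nonneg A) with h0 | h0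
      · rw [← h0]; positivity
      · refine le_of_mul_le_mul_right ?_ h0
        rw [Real.mul_self_sqrt hA0]
        linarith
    calc A = √A ^ 2 := (Real.sq_sqrt hA0).symm
      _ ≤ (√B * Real.exp (τ * |y|)) ^ 2 := by gcongr
      _ = _ := by
        rw [mul_pow, Real.sq_sqrt hB0, ← Real.exp_nat_mul, mul_comm]
        push_cast
        ring_nf
  have hint : Integrable fun x : ℝ => ‖H (x + y * Complex.I)‖ ^ 2 :=
    hy.integrable_norm_pow (by norm_num)
  have hlim := intervalIntegral_tendsto_integral hint (tendsto_neg_atTop_atBot.comp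
    tendsto_natCast_atTop_atTop) (tendsto_natCast_atTop_atTop (R := ℝ))
  refine le_of_tendsto hlim (Eventually.of_forall fun n => ?_)
  have hn : -(n : ℝ) ≤ n := by linarith [(Nat.cast_nonneg n : (0 : ℝ) ≤ n)]
  rw [Function.comp_apply, intervalIntegral.integral_of_le hn, ← integral_Icc_eq_integral_Ioc]
  exact key n

/-- A nonnegative function whose exponential moments `∫ f(s) exp (4 π n σ s)` grow at most like
`exp (2 π n)` vanishes where `σ s > 1/2`. -/
theorem ae_eq_zero_of_exp_moment_le {f : ℝ → ℝ} (hf : ∀ s, 0 ≤ f s) {σ B : ℝ}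
    (hint : ∀ n : ℕ, Integrable fun s => f s * Real.exp (4 * Real.pi * n * (σ * s)))
    (hle : ∀ n : ℕ, ∫ s, f s * Real.exp (4 * Real.pi * n * (σ * s)) ≤
      Real.exp (2 * Real.pi * n) * B) :
    ∀ᵐ s, 1 / 2 < σ * s → f s = 0 := by
  have hfint : Integrable f := by simpa using hint 0
  have key : ∀ m : ℕ, ∀ᵐ s, 1 / 2 + 1 / ((m : ℝ) + 1) ≤ σ * s → f s = 0 := by
    intro m
    set δ : ℝ := 1 / ((m : ℝ) + 1) with hδ
    have hδ0 : 0 < δ := by positivity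
    set S : Set ℝ := {s | 1 / 2 + δ ≤ σ * s} with hS
    have hSm : MeasurableSet S := measurableSet_le measurable_const (by fun_prop)
    have h0 : 0 ≤ ∫ s in S, f s := integral_nonneg hf
    -- On `S` the weight is at least `exp(2πn) exp(4πδn)`; the moment bound absorbs the first
    -- factor, and the second forces the mass of `S` to zero.
    have hb : ∀ n : ℕ, ∫ s in S, f s ≤ Real.exp (-(4 * Real.pi * δ) * n) * B := by
      intro n
      have h1 : Real.exp (4 * Real.pi * n * (1 / 2 + δ)) * ∫ s in S, f s ≤
          Real.exp (2 * Real.pi * n) * B := by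
        rw [← integral_const_mul]
        refine le_trans ?_ (hle n)
        refine le_trans (setIntegral_mono_on (hfint.integrableOn.const_mul _)
          (hint n).integrableOn hSm fun s hs => ?_) (setIntegral_le_integral (hint n)
            (Eventually.of_forall fun s => mul_nonneg (hf s) (Real.exp_nonneg _)))
        rw [mul_comm]
        have hs' : 1 / 2 + δ ≤ σ * s := hs
        have := hf s
        have := Real.pi_pos
        gcongr
      have h2 : Real.exp (2 * Real.pi * n) =
          Real.exp (4 * Real.pi * n * (1 / 2 + δ)) * Real.exp (-(4 * Real.pi * δ) * n) := by
        rw [← Real.exp_add]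
        ring_nf
      rw [h2, mul_assoc (Real.exp _) (Real.exp _) B] at h1
      exact le_of_mul_le_mul_left h1 (Real.exp_pos _)
    have hlim : Tendsto (fun n : ℕ => Real.exp (-(4 * Real.pi * δ) * n) * B) atTop (𝓝 0) := by
      have h1 : Tendsto (fun n : ℕ => -(4 * Real.pi * δ) * (n : ℝ)) atTop atBot :=
        tendsto_natCast_atTop_atTop.const_mul_atTop_of_neg (by
          have := Real.pi_pos
          have : 0 < 4 * Real.pi * δ := by positivity
          linarith)
      simpa using (Real.tendsto_exp_atBot.comp h1).mul_const B
    have hz : ∫ s in S, f s = 0 := le_antisymm (ge_of_tendsto' hlim hb) h0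
    rw [setIntegral_eq_zero_iff_of_nonneg_ae (Eventually.of_forall hf) hfint.integrableOn] at hz
    exact (ae_restrict_iff' hSm).1 hz
  filter_upwards [ae_all_iff.2 key] with s hs hlt
  obtain ⟨m, hm⟩ := exists_nat_one_div_lt (sub_pos.2 hlt)
  exact hs m (by linarith)

/-- **Paley–Wiener theorem**. -/
theorem exists_isBandFun_of_mem_PW2 {g : ℂ → ℂ} (hg : g ∈ PW2) :
    ∃ φ, IsBandFun φ ∧ fourierLaplace φ = g := by
  obtain ⟨hd, htype, h2⟩ := hg
  set G : Lp (α := ℝ) ℂ 2 volume := h2.toLp (fun x : ℝ => g x) with hG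
  set Φ : ℝ → ℂ := ((𝓕 G : Lp (α := ℝ) ℂ 2 volume) : ℝ → ℂ) with hΦ
  have hΦ2 : MemLp Φ 2 := Lp.memLp _
  have hconv : gaussConv g = fourierLaplace fun s : ℝ => Φ s * Real.exp (-Real.pi * s ^ 2) :=
    eq_of_eq_on_real (differentiable_gaussConv hd Real.pi_pos.le htype)
      (differentiable_fourierLaplace_mul_gauss hΦ2) (gaussConv_ofReal h2)
  have hle : ∀ y : ℝ, ∫ s : ℝ,
      ‖Φ s * Real.exp (-Real.pi * s ^ 2)‖ ^ 2 * Real.exp (-4 * Real.pi * y * s) ≤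
      Real.exp (2 * Real.pi * |y|) * ∫ s : ℝ, ‖Φ s * Real.exp (-Real.pi * s ^ 2)‖ ^ 2 := by
    intro y
    have h0 := memLp_fourierLaplace_horizontal hΦ2 0
    have e0 := integral_norm_fourierLaplace_horizontal_sq hΦ2 0
    simp only [Complex.ofReal_zero, zero_mul, add_zero, mul_zero, Real.exp_zero, mul_one] at h0 e0
    rw [← integral_norm_fourierLaplace_horizontal_sq hΦ2 y, ← e0]
    exact (hconv ▸ hasExpTypeAtMost_gaussConv Real.pi_pos.le htype :
      HasExpTypeAtMost _ _).integral_horizontal_le Real.pi_pos.le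
      (differentiable_fourierLaplace_mul_gauss hΦ2) h0 y (memLp_fourierLaplace_horizontal hΦ2 y)
  -- The signs `σ = ±1` treat the two sides of the band; the height `y = -σn` turns `exp(-4πys)`
  -- into `exp(4πnσs)`.
  have hvanish : ∀ σ : ℝ, |σ| = 1 → ∀ᵐ s : ℝ, 1 / 2 < σ * s → Φ s = 0 := by
    intro σ hσ
    have e : ∀ (n : ℕ) (s : ℝ), Real.exp (4 * Real.pi * n * (σ * s)) =
        Real.exp (-4 * Real.pi * (-(σ * n)) * s) := fun n s => by ring_nf
    have := ae_eq_zero_of_exp_moment_le (σ := σ)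
      (f := fun s : ℝ => ‖Φ s * Real.exp (-Real.pi * s ^ 2)‖ ^ 2)
      (fun s => by positivity) (fun n => by
        simp only [e]
        exact integrable_gauss_weight hΦ2 _) (fun n => by
        simp only [e]
        refine (hle _).trans_eq ?_
        rw [abs_neg, abs_mul, hσ, one_mul, Nat.abs_cast])
    filter_upwards [this] with s hs h
    have := hs h
    simpa [Real.exp_ne_zero] using this
  set φ : ℝ → ℂ := (Icc (-(1 / 2) : ℝ) (1 / 2)).indicator Φ with hφ
  have hφΦ : φ =ᵐ[volume] Φ := by
    filter_upwards [hvanish 1 (by simp), hvanish (-1) (by simp)] with s h1 h2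
    by_cases hs : s ∈ Icc (-(1 / 2) : ℝ) (1 / 2)
    · rw [hφ, indicator_of_mem hs]
    · rw [hφ, indicator_of_notMem hs]
      rw [mem_Icc, not_and_or, not_le, not_le] at hs
      rcases hs with hs | hs
      · exact (h2 (by linarith)).symm
      · exact (h1 (by linarith)).symm
  have hband : IsBandFun φ :=
    ⟨hΦ2.indicator measurableSet_Icc, fun s hs => indicator_of_notMem hs _⟩
  refine ⟨φ, hband, ?_⟩
  have hdφ : Differentiable ℂ (fourierLaplace φ) := hband.fourierLaplace_mem_PW2.1
  refine eq_of_eq_on_real hdφ hd ?_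
  -- Without the Gaussian, `L²` inversion recovers `g` almost everywhere on the real line;
  -- continuity and then the identity theorem remove the exceptional set.
  have hae : (fun x : ℝ => fourierLaplace φ x) =ᵐ[volume] fun x : ℝ => g x := by
    have h1 := fourierInv_toLp_ae_eq hband.integrable hband.memLp
    have h3 : hband.memLp.toLp φ = 𝓕 G := Lp.ext (hband.memLp.coeFn_toLp.trans hφΦ)
    rw [h3, FourierTransform.fourierInv_fourier_eq] at h1
    simp only [fourierLaplace_ofReal]
    exact h1.symm.trans h2.coeFn_toLp
  have := hdφ.continuous
  have := hd.continuous
  exact congrFun ((Continuous.ae_eq_iff_eq volume (by fun_prop) (by fun_prop)).1 hae)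

/-! ### The sharp inequality and its equality case. -/

theorem theorem2 (N : ℕ) (a : ℕ → ℝ)
    (hpos : ∀ x ∈ Set.Icc (0 : ℝ) 1, 0 < polyFun N a x) :
    (∀ g ∈ PW2, g 0 = 1 →
      (∀ n ≤ N, Integrable (fun x : ℝ => ‖iteratedDeriv n g (x : ℂ)‖ ^ 2) volume) ∧
      (recipIntegral N a)⁻¹ ≤ ∫ x : ℝ, energyDensity N a g x ∧
      ((recipIntegral N a)⁻¹ = ∫ x : ℝ, energyDensity N a g x ↔
        ∀ z : ℂ, g z = extremalFun N a z)) ∧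
    extremalFun N a ∈ PW2 ∧ extremalFun N a 0 = 1 := by
  have hψ := isBandFun_extremalDensity hpos
  have hψF := fourierLaplace_extremalDensity hpos
  refine ⟨fun g hg hg0 => ?_, hψF ▸ hψ.fourierLaplace_mem_PW2, extremalFun_zero hpos⟩
  obtain ⟨φ, hφ, rfl⟩ := exists_isBandFun_of_mem_PW2 hg
  have hφ1 : ∫ s, φ s = 1 := by rw [← fourierLaplace_zero, hg0]
  have hsq := integral_norm_sq_mul_polyFun hφ hφ1 hpos
  refine ⟨fun n _ => hφ.integrable_norm_iteratedDeriv_sq n, ?_, ?_, ?_⟩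
  · rw [hφ.integral_energyDensity, hsq]
    have : 0 ≤ ∫ s, ‖φ s - extremalDensity N a s‖ ^ 2 * polyFun N a ((2 * s) ^ 2) :=
      integral_nonneg (norm_sub_sq_mul_polyFun_nonneg hφ hψ hpos)
    linarith
  · intro h
    rw [hφ.integral_energyDensity, hsq] at h
    have hae := ae_eq_of_integral_norm_sub_sq_mul_polyFun_eq_zero hφ hψ hpos (by linarith)
    intro z
    rw [fourierLaplace_congr_ae hae, hψF]
  · intro h
    have hψ1 : ∫ s, extremalDensity N a s = 1 := by
      rw [← fourierLaplace_zero, hψF, extremalFun_zero hpos]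
    -- For `φ = ψ` the square in the identity vanishes, so the energy is exactly `1/I`.
    have := integral_norm_sq_mul_polyFun hψ hψ1 hpos
    rw [funext h, ← hψF, hψ.integral_energyDensity, this]
    simp
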